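/- Let $d\ge 1$ be a fixed integer. For $\varepsilon>0$ and $\sigma\ge 0$ let $(X^0_t,\dots,X^d_t)_{t\ge 0}$ be the continuous solution of the system $$X^i_0=i\ (0\le i\le d),\qquad X^0_t=0,\qquad X^d_t=d+\varepsilon t,\qquad dX^i_t=(X^{i+1}_t+X^{i-1}_t-2X^i_t)\,dt+\sigma\,dB^i_t\quad(1\le i\le d-1,\ t\ge 0),$$ where $B^1,\dots,B^{d-1}$ are independent standard Brownian motions. For $1\le i\le d$ let $$\tau^i:=\inf\{t\ge 0: X^i_t-X^{i-1}_t=2\}\quad(\inf\emptyset=\infty),\qquad \tau:=\min_{1\le i\le d}\tau^i .$$ Suppose that $\varepsilon\to 0$ through positive values and that either $\sigma/\varepsilon\to 0$ or $\sigma=0$. Then $$\mathbb P(\tau=\tau^i)\to\begin{cases}1,& i=d,\\ 0,& 1\le i\le d-1,\end{cases}$$ and $$\tau=\frac d\varepsilon-\frac{(d-1)(2d-1)}6+o_P(1),$$ where $o_P(1)$ denotes a quantity that converges to $0$ in probability. -/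

import Mathlib

open MeasureTheory ProbabilityTheory Filter Topology
open scoped NNReal ENNReal

/-- `X` solves the system of stochastic differential equations of a chain of `d + 1` particles with
pulling speed `ε` and noise intensity `σ`, driven by the independent standard Brownian motions
`B 1, …, B (d - 1)`: almost surely the paths `X 0, …, X d` are continuous, particle `i` starts
at `i`, particle `0` stays at `0`, particle `d` is at `d + ε t` at time `t`, and for `0 < i < d`
`dX i = (X (i + 1) + X (i - 1) - 2 X i) dt + σ dB i` (in integrated form; the noise is additive,
so that its stochastic integral over `[0, t]` is `σ B i t`).
Only the indices `0 < i < d` of `B` and `i ≤ d` of `X` play a role. -/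
structure IsBrownianChain {Ω : Type*} [MeasurableSpace Ω] (d : ℕ) (ε σ : ℝ)
    (B X : ℕ → ℝ≥0 → Ω → ℝ) (P : Measure Ω) : Prop where
  brownian : ∀ i, 0 < i → i < d → IsBrownianReal (B i) P
  indep : iIndepFun (fun (i : Set.Ioo 0 d) (ω : Ω) (t : ℝ≥0) => B i t ω) P
  continuous_paths : ∀ᵐ ω ∂P, ∀ i ≤ d, Continuous fun t : ℝ≥0 => X i t ω
  initial : ∀ᵐ ω ∂P, ∀ i ≤ d, X i 0 ω = i
  left_end : ∀ᵐ ω ∂P, ∀ t : ℝ≥0, X 0 t ω = 0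
  right_end : ∀ᵐ ω ∂P, ∀ t : ℝ≥0, X d t ω = d + ε * t
  sde : ∀ᵐ ω ∂P, ∀ i, 0 < i → i < d → ∀ t : ℝ≥0,
    X i t ω = X i 0 ω
      + (∫ s in (0 : ℝ)..t,
          (X (i + 1) s.toNNReal ω + X (i - 1) s.toNNReal ω - 2 * X i s.toNNReal ω))
      + σ * B i t ω

/-- The first time (`⊤` if there is none) at which the bond `i`, between the particles `i - 1`
and `i`, has length `2`; here `i ≥ 1`. -/
noncomputable def bondBreakTime {Ω : Type*} (X : ℕ → ℝ≥0 → Ω → ℝ) (i : ℕ) (ω : Ω) : EReal :=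
  ⨅ (t : ℝ≥0) (_ : X i t ω - X (i - 1) t ω = 2), ((t : ℝ) : EReal)

/-- The break time of the chain: the minimum of the break times of the bonds `1, …, d`. -/
noncomputable def chainBreakTime {Ω : Type*} (d : ℕ) (X : ℕ → ℝ≥0 → Ω → ℝ) (ω : Ω) : EReal :=
  ⨅ i ∈ Finset.Icc 1 d, bondBreakTime X i ω

/-- `Z n = o_P(1)` along the filter `l`: the extended real random variables `Z n`, possibly on
different probability spaces, converge to `0` in probability. -/
def IsLittleOPOne {ι : Type*} {Ω : ι → Type*} [∀ n, MeasurableSpace (Ω n)]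
    (P : ∀ n, Measure (Ω n)) (l : Filter ι) (Z : ∀ n, Ω n → EReal) : Prop :=
  ∀ κ : ℝ, 0 < κ →
    Tendsto (fun n => P n {ω | ENNReal.ofReal κ ≤ (Z n ω).abs}) l (𝓝 0)

/-!
The chain is pulled slowly, so it follows the quasi-static profile `i + i ε t / d + ε q i`, where
`q` (`quasiStatic`) solves the discrete Poisson equation `q (i + 1) + q (i - 1) - 2 * q i = i / d`
with `q 0 = q d = 0`. Along this profile the bond `i` has length
`2 - ε * ((T - t) / d + (d (d - 1) - i (i - 1)) / (2 d))` with
`T = d / ε - (d - 1) (2 d - 1) / 6` (`bond_length_eq`). Thus the bond `d` reaches length `2` at time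
`T`, while at that time the other bonds are shorter than `2` by at least `ε / 2`. It suffices that
the deviation `R` of the chain from the profile is small compared with `ε (1 + T - t)`, uniformly
over times `t` up to shortly after `T` (`lastBondBreaksNear_of_deviation_le`).

The deviation solves the discrete heat equation with Dirichlet boundary conditions, initial value of
order `ε` and noise `σ B`. Over a time interval `[j, j + 1]` the energy estimate
`l2norm_le_of_integral_eq` (discrete Poincaré inequality and Grönwall, after subtracting the noise
increment) shows that the Euclidean norm of `R` is contracted by a fixed factor, up to a multiple of
the oscillation of the noise on that interval. If this oscillation is at most `μ (1 + K - j)` for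
all `j ≤ K`, with `K` slightly larger than `T`, then summing the geometric series gives
`|R t| ≤ A (ε / K + μ) (1 + K - t)` (`exists_abs_deviation_le`).

The oscillation of Brownian motion over a unit interval exceeds `a` with probability at most
`1 / a ^ 2`, by Kolmogorov's maximal inequality along dyadic points and continuity of the paths. As
the allowed levels `μ (1 + K - j)` grow linearly away from `K`, the union bound over all `j ≤ K`
costs only a constant factor: with `μ` a small multiple of `ε`, the exceptional event has probability
`O((σ / ε) ^ 2)`, uniformly in the length of the time horizon
(`measure_exists_increment_gt_le`).
-/

/-! ### Energy estimate for the discrete heat equation -/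

/-- Summation by parts for the discrete Laplacian. At `i = 0` the truncated index `i - 1` is
harmless because `u 0 = 0`. -/
theorem sum_mul_laplacian_eq (u r : ℕ → ℝ) (h0 : u 0 = 0) (n : ℕ) :
    ∑ i ∈ Finset.range n, u i * (r (i + 1) + r (i - 1) - 2 * r i)
      = u n * (r n - r (n - 1))
        - ∑ i ∈ Finset.range n, (u (i + 1) - u i) * (r (i + 1) - r i) := by
  induction n with
  | zero => simp [h0]
  | succ n ih =>
    rw [Finset.sum_range_succ, Finset.sum_range_succ, ih, Nat.add_sub_cancel]
    ring

/-- Discrete Poincaré inequality with a Dirichlet condition at `0`. -/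
theorem sum_sq_le_sq_mul_sum_diff_sq (u : ℕ → ℝ) (h0 : u 0 = 0) (d : ℕ) :
    ∑ i ∈ Finset.range d, u i ^ 2
      ≤ (d : ℝ) ^ 2 * ∑ i ∈ Finset.range d, (u (i + 1) - u i) ^ 2 := by
  have key : ∀ k ∈ Finset.range d,
      u k ^ 2 ≤ d * ∑ i ∈ Finset.range d, (u (i + 1) - u i) ^ 2 := by
    intro k hk
    have hkd : k ≤ d := (Finset.mem_range.1 hk).le
    have h1 : u k = ∑ i ∈ Finset.range k, (u (i + 1) - u i) := by
      rw [Finset.sum_range_sub, h0, sub_zero]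
    calc u k ^ 2 = (∑ i ∈ Finset.range k, (u (i + 1) - u i)) ^ 2 := by rw [← h1]
      _ ≤ (Finset.range k).card * ∑ i ∈ Finset.range k, (u (i + 1) - u i) ^ 2 :=
          sq_sum_le_card_mul_sum_sq
      _ ≤ d * ∑ i ∈ Finset.range d, (u (i + 1) - u i) ^ 2 := by
          rw [Finset.card_range]
          gcongr
  calc ∑ i ∈ Finset.range d, u i ^ 2
      ≤ ∑ _i ∈ Finset.range d, (d * ∑ i ∈ Finset.range d, (u (i + 1) - u i) ^ 2 : ℝ) :=
        Finset.sum_le_sum key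
    _ = _ := by rw [Finset.sum_const, Finset.card_range, nsmul_eq_mul]; ring

/-- The energy `∑ u i ^ 2` is dissipated by the discrete Laplacian of a perturbation `r` of `u`, up
to an error quadratic in the size `m` of the perturbation. -/
theorem energy_dissipation {d : ℕ} (hd : 1 ≤ d) {u r : ℕ → ℝ} {m : ℝ} (h0 : u 0 = 0)
    (h1 : u d = 0) (hm : ∀ i ≤ d, |r i - u i| ≤ m) :
    ∑ i ∈ Finset.range d, 2 * (u i * (r (i + 1) + r (i - 1) - 2 * r i))
      ≤ -(1 / (d : ℝ) ^ 2) * ∑ i ∈ Finset.range d, u i ^ 2 + 4 * d * m ^ 2 := by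
  have hdpos : (0 : ℝ) < d := by exact_mod_cast hd
  have hP := sum_sq_le_sq_mul_sum_diff_sq u h0 d
  have hP' : 1 / (d : ℝ) ^ 2 * ∑ i ∈ Finset.range d, u i ^ 2
      ≤ ∑ i ∈ Finset.range d, (u (i + 1) - u i) ^ 2 := by
    rw [one_div, inv_mul_le_iff₀ (by positivity)]; exact hP
  rw [← Finset.mul_sum, sum_mul_laplacian_eq u r h0, h1, zero_mul, zero_sub]
  have h2 : ∑ i ∈ Finset.range d, ((u (i + 1) - u i) ^ 2 - 4 * m ^ 2)
      ≤ ∑ i ∈ Finset.range d, 2 * ((u (i + 1) - u i) * (r (i + 1) - r i)) := by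
    refine Finset.sum_le_sum fun i hi => ?_
    have hi' := Finset.mem_range.1 hi
    have a1 := abs_le.1 (hm i hi'.le)
    have a2 := abs_le.1 (hm (i + 1) hi')
    have hb : ((r (i + 1) - u (i + 1)) - (r i - u i)) ^ 2 ≤ (2 * m) ^ 2 :=
      sq_le_sq' (by linarith) (by linarith)
    nlinarith [sq_nonneg (r (i + 1) - r i)]
  rw [Finset.sum_sub_distrib, Finset.sum_const, Finset.card_range, nsmul_eq_mul,
    ← Finset.mul_sum] at h2
  linarith

/-- The Euclidean norm of the coordinates `0, …, d - 1` of a sequence; it is applied to sequences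
that vanish at `d`. -/
noncomputable def l2norm (d : ℕ) (u : ℕ → ℝ) : ℝ :=
  Real.sqrt (∑ i ∈ Finset.range d, u i ^ 2)

theorem l2norm_nonneg (d : ℕ) (u : ℕ → ℝ) : 0 ≤ l2norm d u := Real.sqrt_nonneg _

theorem abs_le_l2norm {d : ℕ} (u : ℕ → ℝ) {i : ℕ} (hi : i < d) : |u i| ≤ l2norm d u :=
  Real.abs_le_sqrt (Finset.single_le_sum (f := fun i => u i ^ 2) (fun _ _ => sq_nonneg _)
    (Finset.mem_range.2 hi))

theorem l2norm_le_of_abs_le {d : ℕ} {v : ℕ → ℝ} {m : ℝ} (hm : ∀ i < d, |v i| ≤ m)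
    (hm0 : 0 ≤ m) : l2norm d v ≤ d * m := by
  refine Real.sqrt_le_iff.2 ⟨by positivity, ?_⟩
  calc ∑ i ∈ Finset.range d, v i ^ 2 ≤ ∑ _i ∈ Finset.range d, m ^ 2 :=
        Finset.sum_le_sum fun i hi =>
          sq_le_sq.2 (by rw [abs_of_nonneg hm0]; exact hm i (Finset.mem_range.1 hi))
    _ = d * m ^ 2 := by rw [Finset.sum_const, Finset.card_range, nsmul_eq_mul]
    _ ≤ (d * m) ^ 2 := by
        have : (d : ℝ) ≤ (d : ℝ) ^ 2 := by exact_mod_cast Nat.le_self_pow two_ne_zero d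
        rw [mul_pow]; gcongr

theorem l2norm_add_le (d : ℕ) (u v : ℕ → ℝ) : l2norm d (u + v) ≤ l2norm d u + l2norm d v := by
  have key : ∀ w : ℕ → ℝ, l2norm d w = ‖WithLp.toLp 2 (fun i : Fin d => w i)‖ := fun w => by
    rw [EuclideanSpace.norm_eq, l2norm, Finset.sum_range]
    simp
  rw [key, key, key]
  exact norm_add_le (WithLp.toLp 2 (fun i : Fin d => u i)) (WithLp.toLp 2 (fun i : Fin d => v i))

/-- The contraction factor of the heat flow over a unit of time. -/
noncomputable def contraction (d : ℕ) : ℝ := Real.exp (-(1 / (2 * (d : ℝ) ^ 2)))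

/-- Energy estimate for the heat flow on `{0, …, d}` with Dirichlet boundary conditions, driven by a
noise `b` (not assumed differentiable) of size at most `m`. -/
theorem l2norm_le_of_integral_eq {d : ℕ} (hd : 1 ≤ d) {r b : ℕ → ℝ → ℝ} {a m : ℝ}
    (hm0 : 0 ≤ m) (hr : ∀ i ≤ d, Continuous (r i))
    (hr0 : ∀ t ∈ Set.Icc a (a + 1), r 0 t = 0) (hrd : ∀ t ∈ Set.Icc a (a + 1), r d t = 0)
    (heq : ∀ i, 0 < i → i < d → ∀ t ∈ Set.Icc a (a + 1),
      r i t = r i a + (∫ s in a..t, (r (i + 1) s + r (i - 1) s - 2 * r i s)) + b i t)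
    (hb : ∀ i, 0 < i → i < d → ∀ t ∈ Set.Icc a (a + 1), |b i t| ≤ m)
    {t : ℝ} (ht : t ∈ Set.Icc a (a + 1)) :
    l2norm d (fun i => r i t)
      ≤ Real.exp (-(1 / (2 * (d : ℝ) ^ 2)) * (t - a)) * l2norm d (fun i => r i a)
        + 3 * (d : ℝ) ^ 2 * m := by
  have hdpos : (0 : ℝ) < d := by exact_mod_cast hd
  have hd1 : (1 : ℝ) ≤ d := by exact_mod_cast hd
  have haa : a ∈ Set.Icc a (a + 1) := ⟨le_rfl, by linarith⟩
  -- Removing the noise leaves a differentiable function `u` within distance `m` of `r`.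
  set g : ℕ → ℝ → ℝ := fun i s => r (i + 1) s + r (i - 1) s - 2 * r i s with hg
  set u : ℕ → ℝ → ℝ := fun i t => if 0 < i ∧ i < d then r i a + ∫ s in a..t, g i s else 0 with hu
  have hu0 : ∀ t, u 0 t = 0 := fun t => by simp [hu]
  have hud : ∀ t, u d t = 0 := fun t => by simp [hu]
  have hru : ∀ t ∈ Set.Icc a (a + 1), ∀ i ≤ d, |r i t - u i t| ≤ m := by
    intro t ht i hi
    by_cases h : 0 < i ∧ i < d
    · have : r i t - u i t = b i t := by
        rw [heq i h.1 h.2 t ht]; simp only [hu, if_pos h]; ring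
      rw [this]; exact hb i h.1 h.2 t ht
    · have : i = 0 ∨ i = d := by omega
      rcases this with rfl | rfl
      · rw [hr0 t ht, hu0]; simpa using hm0
      · rw [hrd t ht, hud]; simpa using hm0
  have hua : ∀ i < d, u i a = r i a := by
    intro i hi
    rcases Nat.eq_zero_or_pos i with rfl | h
    · rw [hu0, hr0 a haa]
    · simp [hu, h, hi]
  have hderiv : ∀ i < d, ∀ t, HasDerivAt (fun t => u i t ^ 2) (2 * (u i t * g i t)) t := by
    intro i hi t
    rcases Nat.eq_zero_or_pos i with rfl | h
    · simp only [hu0]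
      simpa using hasDerivAt_const t (0 : ℝ)
    · have hgc : Continuous (g i) :=
        ((hr _ (by omega)).add (hr _ (by omega))).sub ((hr _ (by omega)).const_mul 2)
      have h1 : HasDerivAt (u i) (g i t) t := by
        have h2 := (hgc.integral_hasStrictDerivAt a t).hasDerivAt.const_add (r i a)
        have h3 : u i = fun t => r i a + ∫ s in a..t, g i s := by
          funext t; simp [hu, h, hi]
        rw [h3]; exact h2
      have h2 := h1.pow 2
      refine h2.congr_deriv ?_
      norm_num; ring
  have hE : ∀ t, HasDerivAt (fun t => ∑ i ∈ Finset.range d, u i t ^ 2)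
      (∑ i ∈ Finset.range d, 2 * (u i t * g i t)) t := fun t =>
    HasDerivAt.fun_sum fun i hi => hderiv i (Finset.mem_range.1 hi) t
  have hG := le_gronwallBound_of_liminf_deriv_right_le (a := a) (b := a + 1)
    (f := fun t => ∑ i ∈ Finset.range d, u i t ^ 2)
    (f' := fun t => ∑ i ∈ Finset.range d, 2 * (u i t * g i t))
    (δ := ∑ i ∈ Finset.range d, u i a ^ 2) (K := -(1 / (d : ℝ) ^ 2)) (ε := 4 * d * m ^ 2)
    (fun t _ => (hE t).continuousAt.continuousWithinAt)
    (fun t _ r hr => (hE t).hasDerivWithinAt.liminf_right_slope_le hr) le_rfl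
    (fun t ht => energy_dissipation hd (hu0 t) (hud t) (hru t (Set.Ico_subset_Icc_self ht))) t ht
  have hK : -(1 / (d : ℝ) ^ 2) ≠ 0 := by
    have : (0 : ℝ) < 1 / (d : ℝ) ^ 2 := by positivity
    linarith
  rw [gronwallBound_of_K_ne_0 hK] at hG
  dsimp only at hG
  set e := Real.exp (-(1 / (2 * (d : ℝ) ^ 2)) * (t - a)) with he
  have hee : Real.exp (-(1 / (d : ℝ) ^ 2) * (t - a)) = e ^ 2 := by
    rw [he, ← Real.exp_nat_mul]; congr 1; field_simp; norm_num
  have hepos : 0 < e := Real.exp_pos _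
  have hua' : ∑ i ∈ Finset.range d, u i a ^ 2 = ∑ i ∈ Finset.range d, r i a ^ 2 :=
    Finset.sum_congr rfl fun i hi => by rw [hua i (Finset.mem_range.1 hi)]
  have hNa : ∑ i ∈ Finset.range d, r i a ^ 2 = l2norm d (fun i => r i a) ^ 2 := by
    rw [l2norm, Real.sq_sqrt (Finset.sum_nonneg fun _ _ => sq_nonneg _)]
  have hut : l2norm d (fun i => u i t) ≤ e * l2norm d (fun i => r i a) + 2 * (d : ℝ) ^ 2 * m := by
    have hN := l2norm_nonneg d (fun i => r i a)
    refine Real.sqrt_le_iff.2 ⟨by positivity, hG.trans ?_⟩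
    rw [hee, hua', hNa]
    have h1 : 4 * (d : ℝ) * m ^ 2 / -(1 / (d : ℝ) ^ 2) * (e ^ 2 - 1)
        = 4 * (d : ℝ) ^ 3 * m ^ 2 * (1 - e ^ 2) := by field_simp; ring
    have h2 : 4 * (d : ℝ) ^ 3 * m ^ 2 * (1 - e ^ 2) ≤ 4 * (d : ℝ) ^ 3 * m ^ 2 * 1 := by
      gcongr; nlinarith
    have h3 : 4 * (d : ℝ) ^ 3 * m ^ 2 * 1 ≤ (2 * (d : ℝ) ^ 2 * m) ^ 2 := by
      have : (d : ℝ) ^ 3 ≤ (d : ℝ) ^ 4 := pow_le_pow_right₀ hd1 (by norm_num)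
      nlinarith [mul_le_mul_of_nonneg_right this (sq_nonneg m)]
    have h4 : 0 ≤ e * l2norm d (fun i => r i a) * (2 * (d : ℝ) ^ 2 * m) := by positivity
    rw [h1]
    nlinarith
  have hsplit := l2norm_add_le d (fun i => u i t) (fun i => r i t - u i t)
  have hsum : (fun i => u i t) + (fun i => r i t - u i t) = fun i => r i t := by
    funext i; simp
  rw [hsum] at hsplit
  have hbt : l2norm d (fun i => r i t - u i t) ≤ d * m :=
    l2norm_le_of_abs_le (fun i hi => hru t ht i hi.le) hm0
  have : (d : ℝ) * m ≤ (d : ℝ) ^ 2 * m := by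
    gcongr; nlinarith
  linarith

/-! ### Contractive recursions with linearly weighted forcing -/

theorem contraction_pos (d : ℕ) : 0 < contraction d := Real.exp_pos _

theorem contraction_lt_one {d : ℕ} (hd : 1 ≤ d) : contraction d < 1 := by
  have hdpos : (0 : ℝ) < d := by exact_mod_cast hd
  rw [contraction, Real.exp_lt_one_iff, neg_lt_zero]
  positivity

/-- A contraction with forcing of size `μ (1 + K - k)` at time `k` follows the forcing up to a
constant factor, apart from the exponentially decaying contribution of the initial value. -/
theorem le_of_contraction_recursion {ρ D μ : ℝ} (hρ0 : 0 < ρ) (hρ : ρ < 1) (hD : 0 ≤ D)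
    (hμ : 0 ≤ μ) {K : ℕ} {N : ℕ → ℝ}
    (hN : ∀ k < K, N (k + 1) ≤ ρ * N k + D * (μ * (1 + K - k))) {k : ℕ} (hk : k ≤ K) :
    N k ≤ ρ ^ k * N 0
      + μ * (D / (1 - ρ) * (K - k) + (D + D / (1 - ρ)) / (1 - ρ)) := by
  have h1 : 0 < 1 - ρ := by linarith
  set α := D / (1 - ρ) with hα
  set β := (D + α) / (1 - ρ) with hβ
  have hα' : ρ * α + D = α := by rw [hα]; field_simp; ring
  have hβ' : ρ * β + (D + α) = β := by rw [hβ]; field_simp; ring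
  have hα0 : 0 ≤ α := by positivity
  have hβ0 : 0 ≤ β := by positivity
  induction k with
  | zero =>
    have : 0 ≤ μ * (α * ((K : ℝ) - (0 : ℕ)) + β) := by
      have : (0 : ℝ) ≤ (K : ℝ) - (0 : ℕ) := by simp
      positivity
    simpa using this
  | succ k ih =>
    have ih' := ih (by omega)
    have h2 := hN k (by omega)
    have h3 := mul_le_mul_of_nonneg_left ih' hρ0.le
    have h4 : ρ * (μ * (α * (K - k) + β)) + D * (μ * (1 + K - k))
        = μ * (α * (K - (k + 1 : ℕ)) + β) := by
      push_cast
      linear_combination μ * (K - k) * hα' + μ * hβ'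
    calc N (k + 1) ≤ ρ * (ρ ^ k * N 0 + μ * (α * (K - k) + β)) + D * (μ * (1 + K - k)) := by
          linarith
      _ = ρ ^ (k + 1) * N 0 + (ρ * (μ * (α * (K - k) + β)) + D * (μ * (1 + K - k))) := by ring
      _ = _ := by rw [h4]

/-- A geometric sequence lies below the linear profile `1 + K - k` divided by a multiple of `K`. -/
theorem pow_mul_le_linear {ρ : ℝ} (hρ0 : 0 < ρ) (hρ : ρ < 1) {k K : ℕ} (hk : k ≤ K) :
    ρ ^ k * ((1 - ρ) * K) ≤ 1 + K - k := by
  have hkK : (k : ℝ) ≤ K := by exact_mod_cast hk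
  have hk0 : (0 : ℝ) ≤ k := k.cast_nonneg
  -- Bernoulli's inequality for `1 / ρ`
  have hB : 1 + (k : ℝ) * (1 - ρ) ≤ (ρ⁻¹) ^ k := by
    have h1 : 1 ≤ ρ⁻¹ := (one_le_inv₀ hρ0).2 hρ.le
    have h2 := one_add_mul_sub_le_pow (a := ρ⁻¹) (by linarith) k
    have h3 : 1 - ρ ≤ ρ⁻¹ - 1 := by
      have : ρ * ρ⁻¹ = 1 := mul_inv_cancel₀ hρ0.ne'
      nlinarith [sq_nonneg (1 - ρ), sq_nonneg (ρ⁻¹ - 1)]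
    nlinarith
  have h4 : (1 - ρ) * K ≤ (1 + K - k) * (1 + (k : ℝ) * (1 - ρ)) := by
    have a1 : 0 < 1 - ρ := by linarith
    have a2 : 0 ≤ (K - k : ℝ) * (k * (1 - ρ)) :=
      mul_nonneg (by linarith) (mul_nonneg hk0 a1.le)
    nlinarith
  have hρk : 0 < ρ ^ k := pow_pos hρ0 k
  calc ρ ^ k * ((1 - ρ) * K) ≤ ρ ^ k * ((1 + K - k) * (ρ⁻¹) ^ k) := by
        refine mul_le_mul_of_nonneg_left (h4.trans ?_) hρk.le
        exact mul_le_mul_of_nonneg_left hB (by linarith)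
    _ = 1 + K - k := by
        rw [inv_pow]; field_simp

/-! ### Maximal inequalities -/

/-- The squared partial sums of independent centred square integrable random variables form a
submartingale. -/
theorem submartingale_sq_sum {Ω : Type*} [MeasurableSpace Ω] {P : Measure Ω}
    [IsProbabilityMeasure P] {Y : ℕ → Ω → ℝ} (hm : ∀ i, StronglyMeasurable (Y i))
    (hI : iIndepFun Y P) (h2 : ∀ i, MemLp (Y i) 2 P) (h0 : ∀ i, ∫ ω, Y i ω ∂P = 0) :
    Submartingale (fun n ω => (∑ i ∈ Finset.range (n + 1), Y i ω) ^ 2)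
      (Filtration.natural Y hm) P := by
  set S : ℕ → Ω → ℝ := fun n ω => ∑ i ∈ Finset.range (n + 1), Y i ω with hS
  have hSm : ∀ n, StronglyMeasurable[Filtration.natural Y hm n] (S n) := fun n =>
    Finset.stronglyMeasurable_fun_sum _ fun i hi =>
      (Filtration.stronglyAdapted_natural hm i).mono
        ((Filtration.natural Y hm).mono (Nat.lt_succ_iff.1 (Finset.mem_range.1 hi)))
  have hS2 : ∀ n, MemLp (S n) 2 P := fun n => memLp_finsetSum _ fun i _ => h2 i
  refine submartingale_of_condExp_sub_nonneg_nat (fun n => (hSm n).pow 2)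
    (fun n => (hS2 n).integrable_sq) fun n => ?_
  have hint : Integrable (S n * Y (n + 1)) P := (hS2 n).integrable_mul (h2 (n + 1))
  have hexp : (fun ω => S (n + 1) ω ^ 2) - (fun ω => S n ω ^ 2)
      = (2 : ℝ) • (S n * Y (n + 1)) + fun ω => Y (n + 1) ω ^ 2 := by
    funext ω
    have : S (n + 1) ω = S n ω + Y (n + 1) ω := Finset.sum_range_succ _ _
    simp only [Pi.sub_apply, Pi.add_apply, Pi.smul_apply, Pi.mul_apply, smul_eq_mul, this]
    ring
  change 0 ≤ᵐ[P] P[(fun ω => S (n + 1) ω ^ 2) - (fun ω => S n ω ^ 2)|Filtration.natural Y hm n]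
  rw [hexp]
  have e1 := condExp_add (hint.smul (2 : ℝ)) (h2 (n + 1)).integrable_sq (Filtration.natural Y hm n)
  have e2 := condExp_smul (μ := P) (2 : ℝ) (S n * Y (n + 1)) (Filtration.natural Y hm n)
  have e3 := condExp_mul_of_stronglyMeasurable_left (hSm n) hint
    ((h2 (n + 1)).integrable one_le_two)
  have e4 := hI.condExp_natural_ae_eq_of_lt hm (Nat.lt_succ_self n)
  have e5 : 0 ≤ᵐ[P] P[fun ω => Y (n + 1) ω ^ 2|Filtration.natural Y hm n] :=
    condExp_nonneg (Eventually.of_forall fun ω => sq_nonneg _)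
  filter_upwards [e1, e2, e3, e4, e5] with ω w1 w2 w3 w4 w5
  rw [w1, Pi.add_apply, w2, Pi.smul_apply, w3, Pi.mul_apply, w4, h0, mul_zero, smul_zero, zero_add]
  exact w5

/-- **Kolmogorov's maximal inequality**. -/
theorem measure_exists_abs_sum_ge_le {Ω : Type*} [MeasurableSpace Ω] {P : Measure Ω}
    [IsProbabilityMeasure P] {Y : ℕ → Ω → ℝ} (hI : iIndepFun Y P) (h2 : ∀ i, MemLp (Y i) 2 P)
    (h0 : ∀ i, ∫ ω, Y i ω ∂P = 0) {a : ℝ} (ha : 0 < a) (n : ℕ) :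
    P {ω | ∃ k ≤ n, a ≤ |∑ i ∈ Finset.range (k + 1), Y i ω|}
      ≤ ENNReal.ofReal ((∫ ω, (∑ i ∈ Finset.range (n + 1), Y i ω) ^ 2 ∂P) / a ^ 2) := by
  wlog hm : ∀ i, StronglyMeasurable (Y i) generalizing Y
  · have hae : ∀ i, Y i =ᵐ[P] (h2 i).1.mk (Y i) := fun i => (h2 i).1.ae_eq_mk
    have hall : ∀ᵐ ω ∂P, ∀ i, Y i ω = (h2 i).1.mk (Y i) ω := ae_all_iff.2 hae
    have := this (hI.congr hae) (fun i => (memLp_congr_ae (hae i)).1 (h2 i))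
      (fun i => (integral_congr_ae (hae i)).symm.trans (h0 i))
      (fun i => (h2 i).1.stronglyMeasurable_mk)
    refine (measure_mono_ae ?_).trans (this.trans (ENNReal.ofReal_le_ofReal (le_of_eq ?_)))
    · filter_upwards [hall] with ω hω h
      obtain ⟨k, hk, h⟩ := h
      exact ⟨k, hk, by simpa only [← hω] using h⟩
    · congr 1
      refine integral_congr_ae ?_
      filter_upwards [hall] with ω hω
      simp only [← hω]
  have hsub := submartingale_sq_sum hm hI h2 h0
  have hmax := maximal_ineq hsub (fun n ω => sq_nonneg _) (ε := (a ^ 2).toNNReal) n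
  have ha2 : 0 < a ^ 2 := by positivity
  rw [Real.coe_toNNReal _ ha2.le] at hmax
  have hset : {ω | ∃ k ≤ n, a ≤ |∑ i ∈ Finset.range (k + 1), Y i ω|}
      ⊆ {ω | a ^ 2 ≤ (Finset.range (n + 1)).sup' Finset.nonempty_range_add_one
          fun k => (∑ i ∈ Finset.range (k + 1), Y i ω) ^ 2} := by
    rintro ω ⟨k, hk, h⟩
    rw [Set.mem_ofPred_eq, Finset.le_sup'_iff]
    refine ⟨k, Finset.mem_range.2 (Nat.lt_succ_of_le hk), ?_⟩
    rw [← sq_abs (∑ i ∈ Finset.range (k + 1), Y i ω)]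
    exact pow_le_pow_left₀ ha.le h 2
  have hint : ∫ ω in {ω | a ^ 2 ≤ (Finset.range (n + 1)).sup' Finset.nonempty_range_add_one
          fun k => (∑ i ∈ Finset.range (k + 1), Y i ω) ^ 2},
        (∑ i ∈ Finset.range (n + 1), Y i ω) ^ 2 ∂P
      ≤ ∫ ω, (∑ i ∈ Finset.range (n + 1), Y i ω) ^ 2 ∂P :=
    setIntegral_le_integral (hsub.integrable n) (Eventually.of_forall fun ω => sq_nonneg _)
  have h3 := hmax.trans (ENNReal.ofReal_le_ofReal hint)
  rw [ENNReal.ofReal_div_of_pos ha2]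
  refine (measure_mono hset).trans ?_
  rw [ENNReal.le_div_iff_mul_le (Or.inl (ENNReal.ofReal_pos.2 ha2).ne')
    (Or.inl ENNReal.ofReal_ne_top), mul_comm]
  exact h3

/-- The maximal inequality for the increments of a Brownian motion along the dyadic points of level
`m` of `[j, j + 1]`. -/
theorem ProbabilityTheory.IsPreBrownianReal.measure_exists_dyadic_le {Ω : Type*}
    [MeasurableSpace Ω] {P : Measure Ω} {B : ℝ≥0 → Ω → ℝ} (hB : IsPreBrownianReal B P) (j : ℝ≥0)
    {a : ℝ} (ha : 0 < a) (m : ℕ) :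
    P {ω | ∃ k : ℕ, k < 2 ^ m ∧ a ≤ |B (j + (k + 1 : ℕ) / 2 ^ m) ω - B j ω|}
      ≤ ENNReal.ofReal (1 / a ^ 2) := by
  have : IsProbabilityMeasure P := hB.isGaussianProcess.isProbabilityMeasure
  set t : ℕ → ℝ≥0 := fun k => j + (k : ℝ≥0) / 2 ^ m with ht
  have hmono : Monotone t := fun k l hkl => by
    simp only [ht]
    gcongr
  have hlaw := fun k => hB.hasLaw_sub (t (k + 1)) (t k)
  have hsum : ∀ k ω, ∑ i ∈ Finset.range (k + 1), (B (t (i + 1)) ω - B (t i) ω)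
      = B (j + (k + 1 : ℕ) / 2 ^ m) ω - B j ω := fun k ω => by
    rw [Finset.sum_range_sub (fun i => B (t i) ω)]
    simp [ht]
  have hK := measure_exists_abs_sum_ge_le (hB.hasIndepIncrements.nat hmono)
    (fun k => (hlaw k).hasGaussianLaw.memLp_two)
    (fun k => (hlaw k).integral_eq.trans integral_id_gaussianReal) ha (2 ^ m - 1)
  have h2m : 2 ^ m - 1 + 1 = 2 ^ m := Nat.sub_add_cancel Nat.one_le_two_pow
  simp only [hsum] at hK
  have hlast : ∫ ω, (B (j + (2 ^ m - 1 + 1 : ℕ) / 2 ^ m) ω - B j ω) ^ 2 ∂P = 1 := by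
    have hl := hB.hasLaw_sub (j + (2 ^ m - 1 + 1 : ℕ) / 2 ^ m) j
    have hv := hl.variance_eq
    rw [variance_id_gaussianReal, variance_of_integral_eq_zero hl.aemeasurable
      (hl.integral_eq.trans integral_id_gaussianReal)] at hv
    refine hv.trans ?_
    rw [h2m]
    simp [nndist_eq_nnnorm]
  rw [hlast] at hK
  refine (measure_mono ?_).trans hK
  rintro ω ⟨k, hk, h⟩
  exact ⟨k, by omega, h⟩

/-- Maximal inequality for the oscillation of a Brownian motion over a unit of time. -/
theorem ProbabilityTheory.IsBrownianReal.measure_exists_abs_sub_gt_le {Ω : Type*}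
    [MeasurableSpace Ω] {P : Measure Ω} {B : ℝ≥0 → Ω → ℝ} (hB : IsBrownianReal B P) (j : ℝ≥0)
    {a : ℝ} (ha : 0 < a) :
    P {ω | ∃ s : ℝ≥0, s ≤ 1 ∧ a < |B (j + s) ω - B j ω|} ≤ ENNReal.ofReal (1 / a ^ 2) := by
  set E : ℕ → Set Ω := fun m =>
    {ω | ∃ k : ℕ, k < 2 ^ m ∧ a ≤ |B (j + (k + 1 : ℕ) / 2 ^ m) ω - B j ω|} with hE
  have hmono : Monotone E := by
    refine monotone_nat_of_le_succ fun m ω h => ?_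
    obtain ⟨k, hk, h⟩ := h
    refine ⟨2 * k + 1, by rw [pow_succ]; omega, ?_⟩
    have : ((2 * k + 1 + 1 : ℕ) : ℝ≥0) / 2 ^ (m + 1) = (k + 1 : ℕ) / 2 ^ m := by
      push_cast
      rw [pow_succ]
      field_simp
      ring
    rwa [this]
  have hsub : ∀ᵐ ω ∂P, ω ∈ {ω | ∃ s : ℝ≥0, s ≤ 1 ∧ a < |B (j + s) ω - B j ω|} → ω ∈ ⋃ m, E m := by
    filter_upwards [hB.cont] with ω hω
    rintro ⟨s, hs1, hs⟩
    have hs0 : 0 < s := by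
      rcases eq_or_ne s 0 with rfl | h
      · simp at hs; linarith
      · exact pos_of_ne_zero h
    -- the dyadic approximations `⌈s 2 ^ m⌉ / 2 ^ m` of `s`
    have hlim : Tendsto (fun m : ℕ => ((⌈(s : ℝ) * 2 ^ m⌉₊ : ℝ)) / 2 ^ m) atTop (𝓝 s) :=
      (tendsto_nat_ceil_mul_div_atTop s.2).comp (tendsto_pow_atTop_atTop_of_one_lt one_lt_two)
    have hlim' : Tendsto (fun m : ℕ => j + (⌈(s : ℝ) * 2 ^ m⌉₊ : ℝ≥0) / 2 ^ m) atTop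
        (𝓝 (j + s)) := by
      refine Tendsto.const_add j ?_
      rw [← NNReal.tendsto_coe]
      push_cast
      exact hlim
    have hc : Tendsto (fun m : ℕ => |B (j + (⌈(s : ℝ) * 2 ^ m⌉₊ : ℝ≥0) / 2 ^ m) ω - B j ω|) atTop
        (𝓝 |B (j + s) ω - B j ω|) :=
      (((hω.tendsto _).comp hlim').sub_const _).abs
    obtain ⟨m, hm⟩ := (hc.eventually (lt_mem_nhds hs)).exists
    have hpos : 0 < ⌈(s : ℝ) * 2 ^ m⌉₊ := Nat.ceil_pos.2 (by positivity)
    have hle : ⌈(s : ℝ) * 2 ^ m⌉₊ ≤ 2 ^ m := by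
      refine Nat.ceil_le.2 ?_
      push_cast
      have : (s : ℝ) ≤ 1 := by exact_mod_cast hs1
      exact mul_le_of_le_one_left (by positivity) this
    refine Set.mem_iUnion.2 ⟨m, ⌈(s : ℝ) * 2 ^ m⌉₊ - 1, by omega, ?_⟩
    rw [Nat.sub_add_cancel hpos]
    exact hm.le
  refine (measure_mono_ae (t := ⋃ m, E m) hsub).trans ?_
  rw [hmono.measure_iUnion]
  exact iSup_le fun m => hB.measure_exists_dyadic_le j ha m

/-- Union bound: the levels `μ (1 + K - j)` grow linearly in the distance of the time `j` to the
horizon `K`, so that the bounds from the maximal inequality are summable uniformly in `K`. -/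
theorem measure_exists_increment_gt_le {Ω : Type*} [MeasurableSpace Ω] {P : Measure Ω} {d : ℕ}
    {B : ℕ → ℝ≥0 → Ω → ℝ} (hB : ∀ i, 0 < i → i < d → IsBrownianReal (B i) P) {σ μ : ℝ}
    (hσ : 0 ≤ σ) (hμ : 0 < μ) (K : ℕ) :
    P {ω | ∃ j : ℕ, j ≤ K ∧ ∃ i, 0 < i ∧ i < d ∧ ∃ s : ℝ≥0, s ≤ 1 ∧
        μ * (1 + K - j) < |σ * B i (j + s) ω - σ * B i j ω|}
      ≤ ENNReal.ofReal (d * (∑' n : ℕ, 1 / ((n : ℝ) + 1) ^ 2) * (σ / μ) ^ 2) := by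
  set S : ℕ → ℕ → Set Ω := fun j i => {ω | ∃ s : ℝ≥0, s ≤ 1 ∧
        μ * (1 + K - j) < |σ * B i (j + s) ω - σ * B i j ω|} with hS
  have hSle : ∀ j ∈ Finset.range (K + 1), ∀ i ∈ Finset.Ioo 0 d,
      P (S j i) ≤ ENNReal.ofReal ((σ / μ) ^ 2 * (1 / (1 + K - j) ^ 2)) := by
    intro j hj i hi
    have hjK : (j : ℝ) ≤ K := by exact_mod_cast Nat.lt_succ_iff.1 (Finset.mem_range.1 hj)
    have hpos : (0 : ℝ) < 1 + K - j := by linarith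
    rcases hσ.eq_or_lt with h0 | hσ0
    · have : S j i = ∅ := by
        refine Set.eq_empty_of_forall_notMem fun ω => ?_
        rintro ⟨s, -, hs⟩
        rw [← h0] at hs
        simp only [zero_mul, sub_zero, abs_zero] at hs
        exact absurd hs (not_lt.2 (by positivity))
      rw [this, measure_empty]
      exact zero_le
    · have ha : 0 < μ * (1 + K - j) / σ := by positivity
      have hb := (hB i (Finset.mem_Ioo.1 hi).1 (Finset.mem_Ioo.1 hi).2).measure_exists_abs_sub_gt_le
        (j : ℝ≥0) ha
      refine (measure_mono ?_).trans (hb.trans (ENNReal.ofReal_le_ofReal (le_of_eq ?_)))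
      · rintro ω ⟨s, hs1, hs⟩
        refine ⟨s, hs1, ?_⟩
        rw [← mul_sub, abs_mul, abs_of_pos hσ0] at hs
        rw [div_lt_iff₀ hσ0, mul_comm _ σ]
        exact hs
      · field_simp
  have hsub : {ω | ∃ j : ℕ, j ≤ K ∧ ∃ i, 0 < i ∧ i < d ∧ ∃ s : ℝ≥0, s ≤ 1 ∧
        μ * (1 + K - j) < |σ * B i (j + s) ω - σ * B i j ω|}
      ⊆ ⋃ j ∈ Finset.range (K + 1), ⋃ i ∈ Finset.Ioo 0 d, S j i := by
    rintro ω ⟨j, hj, i, hi0, hid, h⟩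
    simp only [Set.mem_iUnion]
    exact ⟨j, Finset.mem_range.2 (Nat.lt_succ_of_le hj), i, Finset.mem_Ioo.2 ⟨hi0, hid⟩, h⟩
  have hsum : ∑ j ∈ Finset.range (K + 1), 1 / (1 + (K : ℝ) - j) ^ 2
      ≤ ∑' n : ℕ, 1 / ((n : ℝ) + 1) ^ 2 := by
    rw [← Finset.sum_range_reflect]
    have hs : Summable fun n : ℕ => 1 / ((n : ℝ) + 1) ^ 2 := by
      have := (summable_nat_add_iff 1).2 (Real.summable_one_div_nat_pow.2 one_lt_two)
      simpa using this
    refine (Finset.sum_le_sum fun j hj => le_of_eq ?_).trans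
      (hs.sum_le_tsum (Finset.range (K + 1)) fun n _ => by positivity)
    have hj' : j ≤ K := Nat.lt_succ_iff.1 (Finset.mem_range.1 hj)
    rw [show K + 1 - 1 - j = K - j by omega, Nat.cast_sub hj']
    congr 2
    ring
  calc _ ≤ P (⋃ j ∈ Finset.range (K + 1), ⋃ i ∈ Finset.Ioo 0 d, S j i) := measure_mono hsub
    _ ≤ ∑ j ∈ Finset.range (K + 1), P (⋃ i ∈ Finset.Ioo 0 d, S j i) :=
        measure_biUnion_finset_le _ _
    _ ≤ ∑ j ∈ Finset.range (K + 1), ∑ i ∈ Finset.Ioo 0 d, P (S j i) :=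
        Finset.sum_le_sum fun j _ => measure_biUnion_finset_le _ _
    _ ≤ ∑ j ∈ Finset.range (K + 1), ∑ i ∈ Finset.Ioo 0 d,
          ENNReal.ofReal ((σ / μ) ^ 2 * (1 / (1 + K - j) ^ 2)) :=
        Finset.sum_le_sum fun j hj => Finset.sum_le_sum fun i hi => hSle j hj i hi
    _ = ENNReal.ofReal (∑ j ∈ Finset.range (K + 1), ∑ i ∈ Finset.Ioo 0 d,
          ((σ / μ) ^ 2 * (1 / (1 + K - j) ^ 2))) := by
        rw [ENNReal.ofReal_sum_of_nonneg fun j _ => Finset.sum_nonneg fun i _ => by positivity]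
        exact Finset.sum_congr rfl fun j _ =>
          (ENNReal.ofReal_sum_of_nonneg fun i _ => by positivity).symm
    _ ≤ _ := by
        refine ENNReal.ofReal_le_ofReal ?_
        simp only [Finset.sum_const, Nat.card_Ioo, nsmul_eq_mul]
        rw [← Finset.mul_sum, ← Finset.mul_sum]
        have hd' : ((d - 0 - 1 : ℕ) : ℝ) ≤ d := by exact_mod_cast (by omega : d - 0 - 1 ≤ d)
        have hs0 : 0 ≤ ∑ j ∈ Finset.range (K + 1), 1 / (1 + (K : ℝ) - j) ^ 2 :=
          Finset.sum_nonneg fun j _ => by positivity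
        calc _ ≤ (d : ℝ) * ((σ / μ) ^ 2 * ∑' n : ℕ, 1 / ((n : ℝ) + 1) ^ 2) := by gcongr
          _ = _ := by ring

/-! ### Deviation from the quasi-static profile -/

/-- The quasi-static correction: the solution `q` of `q (i + 1) + q (i - 1) - 2 * q i = i / d` with
`q 0 = q d = 0`. -/
noncomputable def quasiStatic (d i : ℕ) : ℝ := ((i : ℝ) ^ 3 - (d : ℝ) ^ 2 * i) / (6 * d)

/-- The deviation of the chain `x` from the quasi-static profile `i + i ε t / d + ε q i`. -/
noncomputable def deviation (d : ℕ) (ε : ℝ) (x : ℕ → ℝ≥0 → ℝ) (i : ℕ) (t : ℝ) : ℝ :=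
  x i t.toNNReal - (i + i * (ε * t / d) + ε * quasiStatic d i)

theorem laplacian_deviation {d : ℕ} (hd : 1 ≤ d) (ε : ℝ) (x : ℕ → ℝ≥0 → ℝ) {i : ℕ} (hi : 0 < i)
    (t : ℝ) :
    deviation d ε x (i + 1) t + deviation d ε x (i - 1) t - 2 * deviation d ε x i t
      = x (i + 1) t.toNNReal + x (i - 1) t.toNNReal - 2 * x i t.toNNReal - ε * i / d := by
  have hdpos : (0 : ℝ) < d := by exact_mod_cast hd
  simp only [deviation, quasiStatic]
  rw [Nat.cast_sub hi]
  push_cast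
  field_simp
  ring

/-- A realisation of the chain, driven by the noise path `b`. -/
structure IsChainPath (d : ℕ) (ε : ℝ) (b x : ℕ → ℝ≥0 → ℝ) : Prop where
  continuous : ∀ i ≤ d, Continuous (x i)
  initial : ∀ i ≤ d, x i 0 = i
  left_end : ∀ t, x 0 t = 0
  right_end : ∀ t, x d t = d + ε * t
  integral_eq : ∀ i, 0 < i → i < d → ∀ t : ℝ≥0, x i t = x i 0
    + (∫ s in (0 : ℝ)..t, (x (i + 1) s.toNNReal + x (i - 1) s.toNNReal - 2 * x i s.toNNReal))
    + b i t

namespace IsChainPath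

variable {d : ℕ} {ε : ℝ} {b x : ℕ → ℝ≥0 → ℝ}

theorem continuous_deviation (h : IsChainPath d ε b x) {i : ℕ} (hi : i ≤ d) :
    Continuous (deviation d ε x i) := by
  have h1 := (h.continuous i hi).comp continuous_real_toNNReal
  unfold deviation
  exact h1.sub (by fun_prop)

theorem deviation_left (h : IsChainPath d ε b x) (t : ℝ) : deviation d ε x 0 t = 0 := by
  simp [deviation, quasiStatic, h.left_end]

theorem deviation_right (h : IsChainPath d ε b x) (hd : 1 ≤ d) {t : ℝ} (ht : 0 ≤ t) :
    deviation d ε x d t = 0 := by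
  have hdpos : (0 : ℝ) < d := by exact_mod_cast hd
  simp only [deviation, quasiStatic, h.right_end, Real.coe_toNNReal t ht]
  field_simp
  ring

/-- The deviation solves the heat equation without drift, started at any time `a ≥ 0`. -/
theorem deviation_integral_eq (h : IsChainPath d ε b x) (hd : 1 ≤ d) {i : ℕ} (hi0 : 0 < i)
    (hid : i < d) {a t : ℝ} (ha : 0 ≤ a) (hat : a ≤ t) :
    deviation d ε x i t = deviation d ε x i a
      + (∫ s in a..t, (deviation d ε x (i + 1) s + deviation d ε x (i - 1) s
          - 2 * deviation d ε x i s))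
      + (b i t.toNNReal - b i a.toNNReal) := by
  have hdpos : (0 : ℝ) < d := by exact_mod_cast hd
  have hc : Continuous fun s : ℝ =>
      x (i + 1) s.toNNReal + x (i - 1) s.toNNReal - 2 * x i s.toNNReal := by
    have h1 := (h.continuous (i + 1) hid).comp continuous_real_toNNReal
    have h2 := (h.continuous (i - 1) (by omega)).comp continuous_real_toNNReal
    have h3 := (h.continuous i hid.le).comp continuous_real_toNNReal
    exact (h1.add h2).sub (h3.const_mul 2)
  have e1 := h.integral_eq i hi0 hid t.toNNReal
  have e2 := h.integral_eq i hi0 hid a.toNNReal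
  rw [Real.coe_toNNReal t (ha.trans hat)] at e1
  rw [Real.coe_toNNReal a ha] at e2
  have e3 := intervalIntegral.integral_add_adjacent_intervals (a := 0) (b := a) (c := t)
    (hc.intervalIntegrable (μ := volume) 0 a) (hc.intervalIntegrable (μ := volume) a t)
  simp only [laplacian_deviation hd ε x hi0]
  rw [intervalIntegral.integral_sub (hc.intervalIntegrable (μ := volume) a t) (by simp),
    intervalIntegral.integral_const, smul_eq_mul]
  simp only [deviation]
  rw [e1, e2, ← e3]
  field_simp
  ring

end IsChainPath

/-- If over the unit interval starting at `j` the noise oscillates by at most `μ (1 + K - j)`, then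
the deviation at time `t` is of order `(ε / K + μ) (1 + K - t)`: the effect of the initial
value `O(ε)` decays exponentially, and that of the noise is summed with exponentially decaying
weights. -/
theorem exists_abs_deviation_le {d : ℕ} (hd : 1 ≤ d) :
    ∃ A : ℝ, 0 < A ∧ ∀ (ε μ : ℝ) (K : ℕ) (b x : ℕ → ℝ≥0 → ℝ), 0 < ε → 0 ≤ μ → 0 < K →
      IsChainPath d ε b x →
      (∀ j : ℕ, j ≤ K → ∀ i, 0 < i → i < d → ∀ s : ℝ≥0, s ≤ 1 →
        |b i (j + s) - b i j| ≤ μ * (1 + K - j)) →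
      ∀ t : ℝ, 0 ≤ t → t ≤ K → ∀ i ≤ d,
        |deviation d ε x i t| ≤ A * (ε / K + μ) * (1 + K - ⌊t⌋₊) := by
  set ρ := contraction d with hρ
  have hρ0 : 0 < ρ := contraction_pos d
  have hρ1 : ρ < 1 := contraction_lt_one hd
  have h1ρ : 0 < 1 - ρ := by linarith
  set D : ℝ := 3 * (d : ℝ) ^ 2 with hD
  have hD0 : 0 ≤ D := by positivity
  set α : ℝ := D / (1 - ρ) with hα
  set β : ℝ := (D + α) / (1 - ρ) with hβ
  have hα0 : 0 ≤ α := by positivity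
  have hβ0 : 0 ≤ β := by positivity
  set C : ℝ := l2norm d (quasiStatic d) with hC
  have hC0 : 0 ≤ C := l2norm_nonneg _ _
  refine ⟨C / (1 - ρ) + (α + β + D) + 1, by positivity, ?_⟩
  intro ε μ K b x hε hμ hK hx hb t ht0 htK i hi
  have hKpos : (0 : ℝ) < K := by exact_mod_cast hK
  have hstep : ∀ j : ℕ, j ≤ K → ∀ t ∈ Set.Icc (j : ℝ) (j + 1),
      l2norm d (fun i => deviation d ε x i t)
        ≤ Real.exp (-(1 / (2 * (d : ℝ) ^ 2)) * (t - j)) * l2norm d (fun i => deviation d ε x i j)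
          + D * (μ * (1 + K - j)) := by
    intro j hj t ht
    have hjK : (j : ℝ) ≤ K := by exact_mod_cast hj
    have hj0 : (0 : ℝ) ≤ j := j.cast_nonneg
    refine l2norm_le_of_integral_eq hd (r := deviation d ε x) (a := (j : ℝ))
      (b := fun i t => b i t.toNNReal - b i (j : ℝ).toNNReal)
      (m := μ * (1 + K - j)) (mul_nonneg hμ (by linarith))
      (fun i hi => hx.continuous_deviation hi) (fun t _ => hx.deviation_left t)
      (fun t ht => hx.deviation_right hd (hj0.trans ht.1))
      (fun i hi0 hid t ht => hx.deviation_integral_eq hd hi0 hid hj0 ht.1) ?_ ht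
    intro i hi0 hid t ht
    have h1 := hb j hj i hi0 hid (t - j).toNNReal
      (Real.toNNReal_le_one.2 (by linarith [ht.2]))
    have h2 : (j : ℝ≥0) + (t - j).toNNReal = t.toNNReal := by
      rw [← Real.toNNReal_natCast, ← Real.toNNReal_add hj0 (by linarith [ht.1])]
      congr 1; ring
    rw [h2] at h1
    simpa only [Real.toNNReal_natCast] using h1
  have hN0 : l2norm d (fun i => deviation d ε x i (0 : ℕ)) = ε * C := by
    have : ∀ i ∈ Finset.range d, deviation d ε x i (0 : ℕ) ^ 2 = ε ^ 2 * quasiStatic d i ^ 2 := by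
      intro i hi
      simp only [deviation, Nat.cast_zero, Real.toNNReal_zero,
        hx.initial i (Finset.mem_range.1 hi).le]
      ring
    rw [l2norm, Finset.sum_congr rfl this, ← Finset.mul_sum, Real.sqrt_mul (sq_nonneg ε),
      Real.sqrt_sq hε.le, hC, l2norm]
  set k := ⌊t⌋₊ with hk
  have hkt : (k : ℝ) ≤ t := Nat.floor_le ht0
  have htk : t ≤ k + 1 := (Nat.lt_floor_add_one t).le
  have hkK : k ≤ K := by exact_mod_cast hkt.trans htK
  have hkK' : (k : ℝ) ≤ K := by exact_mod_cast hkK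
  have hrec := le_of_contraction_recursion hρ0 hρ1 hD0 hμ (K := K)
    (N := fun j => l2norm d (fun i => deviation d ε x i (j : ℕ)))
    (fun j hj => by
      have := hstep j hj.le (j + 1) ⟨by linarith, le_rfl⟩
      rw [add_sub_cancel_left, mul_one] at this
      push_cast
      exact this) hkK
  simp only [hN0] at hrec
  have hNt := hstep k hkK t ⟨hkt, htk⟩
  have hexp : Real.exp (-(1 / (2 * (d : ℝ) ^ 2)) * (t - k)) ≤ 1 := by
    refine Real.exp_le_one_iff.2 ?_
    have : 0 ≤ 1 / (2 * (d : ℝ) ^ 2) := by positivity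
    nlinarith
  have hNt' := hNt.trans (add_le_add_left
    (mul_le_of_le_one_left (l2norm_nonneg _ _) hexp) _)
  have hw : 1 ≤ 1 + (K : ℝ) - k := by linarith
  have hinit : ρ ^ k * (ε * C) ≤ C / (1 - ρ) * (ε / K) * (1 + K - k) := by
    have h1 := pow_mul_le_linear hρ0 hρ1 hkK
    have h2 : ρ ^ k * (ε * C) = ε * C / ((1 - ρ) * K) * (ρ ^ k * ((1 - ρ) * K)) := by
      field_simp
    rw [h2]
    calc _ ≤ ε * C / ((1 - ρ) * K) * (1 + K - k) := by gcongr
      _ = _ := by field_simp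
  have hnoise : μ * (α * (K - k) + β) + D * (μ * (1 + K - k))
      ≤ (α + β + D) * μ * (1 + K - k) := by
    have h1 : 0 ≤ μ * α := by positivity
    have h2 : 0 ≤ μ * β * (1 + K - k - 1) := mul_nonneg (by positivity) (by linarith)
    nlinarith
  have htot : l2norm d (fun i => deviation d ε x i t)
      ≤ (C / (1 - ρ) + (α + β + D) + 1) * (ε / K + μ) * (1 + K - k) := by
    have h1 : C / (1 - ρ) * (ε / K) + (α + β + D) * μ
        ≤ (C / (1 - ρ) + (α + β + D) + 1) * (ε / K + μ) := by
      have a1 : 0 ≤ C / (1 - ρ) * μ := by positivity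
      have a2 : 0 ≤ (α + β + D) * (ε / K) := by positivity
      have a3 : 0 ≤ ε / K := by positivity
      nlinarith
    have h2 := mul_le_mul_of_nonneg_right h1 (by linarith : 0 ≤ 1 + (K : ℝ) - k)
    linarith
  rcases hi.lt_or_eq with hid | rfl
  · exact (abs_le_l2norm (fun i => deviation d ε x i t) hid).trans htot
  · rw [hx.deviation_right hd ht0, abs_zero]
    exact (l2norm_nonneg _ _).trans htot

/-! ### Bond lengths and break times -/

/-- The asymptotic break time of the last bond. -/
noncomputable def asymptoticBreakTime (d : ℕ) (ε : ℝ) : ℝ :=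
  (d : ℝ) / ε - ((d : ℝ) - 1) * (2 * (d : ℝ) - 1) / 6

theorem bond_length_eq {d : ℕ} (hd : 1 ≤ d) {ε : ℝ} (hε : 0 < ε) (x : ℕ → ℝ≥0 → ℝ) {i : ℕ}
    (hi : 1 ≤ i) {t : ℝ} :
    x i t.toNNReal - x (i - 1) t.toNNReal
      = 2 - ε * ((asymptoticBreakTime d ε - t) / d + (d * (d - 1) - i * (i - 1)) / (2 * d))
        + (deviation d ε x i t - deviation d ε x (i - 1) t) := by
  have hdpos : (0 : ℝ) < d := by exact_mod_cast hd
  simp only [deviation, quasiStatic, asymptoticBreakTime]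
  rw [Nat.cast_sub hi]
  push_cast
  field_simp
  ring

/-- The last bond breaks first, and within `κ` of the time `T`. -/
def LastBondBreaksNear {Ω : Type*} (d : ℕ) (X : ℕ → ℝ≥0 → Ω → ℝ) (T κ : ℝ) (ω : Ω) : Prop :=
  chainBreakTime d X ω = bondBreakTime X d ω
    ∧ (∀ i, 1 ≤ i → i < d → chainBreakTime d X ω ≠ bondBreakTime X i ω)
    ∧ (chainBreakTime d X ω - (T : EReal)).abs ≤ ENNReal.ofReal κ

/-- A deviation that is small compared with `ε` near the asymptotic break time `T`, and compared with
`ε (T - t)` at distant times `t`, does not affect which bond breaks, nor (up to `κ`) when. The bound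
`κ ≤ 1 / 4` is used because the other bonds lag behind the last one by only `ε / 2`. -/
theorem lastBondBreaksNear_of_deviation_le {Ω : Type*} {d : ℕ} (hd : 1 ≤ d) {ε κ δ : ℝ}
    (hε : 0 < ε) (hκ0 : 0 < κ) (hκ : κ ≤ 1 / 4) (hδ : δ = κ / (64 * d)) {b : ℕ → ℝ≥0 → ℝ}
    {X : ℕ → ℝ≥0 → Ω → ℝ} {ω : Ω} (hx : IsChainPath d ε b (fun i t => X i t ω))
    (hT : 0 ≤ asymptoticBreakTime d ε)
    (hres : ∀ t : ℝ, 0 ≤ t → t ≤ asymptoticBreakTime d ε + 1 → ∀ i ≤ d,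
      |deviation d ε (fun i t => X i t ω) i t| ≤ δ * ε * (asymptoticBreakTime d ε - t + 4)) :
    LastBondBreaksNear d X (asymptoticBreakTime d ε) κ ω := by
  set T := asymptoticBreakTime d ε with hTdef
  have hd1 : (1 : ℝ) ≤ d := by exact_mod_cast hd
  have hdpos : (0 : ℝ) < d := by linarith
  have hdiff : ∀ t : ℝ, 0 ≤ t → t ≤ T + 1 → ∀ i ≤ d,
      |deviation d ε (fun i t => X i t ω) i t - deviation d ε (fun i t => X i t ω) (i - 1) t|
        ≤ ε * (κ * (T - t + 4) / (32 * d)) := by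
    intro t ht0 ht i hi
    refine (abs_sub _ _).trans ((add_le_add (hres t ht0 ht i hi)
      (hres t ht0 ht (i - 1) (by omega))).trans (le_of_eq ?_))
    rw [hδ]; field_simp; ring
  have hprof : ∀ i, 1 ≤ i → i ≤ d →
      (0 : ℝ) ≤ ((d : ℝ) * (d - 1) - i * (i - 1)) / (2 * d) := by
    intro i hi hid
    have h1 : (1 : ℝ) ≤ i := by exact_mod_cast hi
    have h2 : (i : ℝ) ≤ d := by exact_mod_cast hid
    refine div_nonneg ?_ (by positivity)
    nlinarith
  have hprof' : ∀ i, 1 ≤ i → i < d →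
      (1 / 2 : ℝ) ≤ ((d : ℝ) * (d - 1) - i * (i - 1)) / (2 * d) := by
    intro i hi hid
    have h1 : (1 : ℝ) ≤ i := by exact_mod_cast hi
    have h2 : (i : ℝ) + 1 ≤ d := by exact_mod_cast hid
    rw [le_div_iff₀ (by positivity)]
    nlinarith
  -- `hprof` and `hprof'` bound the lag of the bond `i` behind the last one, in units of `ε`;
  -- no bond breaks up to time `T - κ`
  have hearly : ∀ i, 1 ≤ i → i ≤ d → ∀ t : ℝ≥0, (t : ℝ) ≤ T - κ → X i t ω - X (i - 1) t ω < 2 := by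
    intro i hi hid t ht
    have e := bond_length_eq hd hε (fun i t => X i t ω) hi (t := t)
    have h1 := (abs_le.1 (hdiff t t.2 (by linarith) i hid)).2
    have h2 := hprof i hi hid
    have h3 : κ * (T - t + 4) / (32 * d) < (T - t) / d := by
      rw [div_lt_div_iff₀ (by positivity) hdpos]
      have : κ * (T - t + 4) < 32 * (T - t) := by nlinarith
      nlinarith
    have h4 := mul_lt_mul_of_pos_left
      (show κ * (T - t + 4) / (32 * d)
        < (T - t) / d + ((d : ℝ) * (d - 1) - i * (i - 1)) / (2 * d) by linarith) hε
    simp only [Real.toNNReal_coe] at e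
    linarith
  -- the other bonds do not break up to time `T + κ`
  have hother : ∀ i, 1 ≤ i → i < d → ∀ t : ℝ≥0, (t : ℝ) ≤ T + κ →
      X i t ω - X (i - 1) t ω < 2 := by
    intro i hi hid t ht
    rcases le_total (t : ℝ) (T - κ) with h | h
    · exact hearly i hi hid.le t h
    have e := bond_length_eq hd hε (fun i t => X i t ω) hi (t := t)
    have h1 := (abs_le.1 (hdiff t t.2 (by linarith) i hid.le)).2
    have h2 := hprof' i hi hid
    have h3 : κ * (T - t + 4) / (32 * d) ≤ 1 / 8 := by
      rw [div_le_iff₀ (by positivity)]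
      nlinarith
    have h5 : -(1 / 4) ≤ (T - t) / d := by
      rw [le_div_iff₀ hdpos]
      nlinarith
    have h4 := mul_lt_mul_of_pos_left
      (show κ * (T - t + 4) / (32 * d)
        < (T - t) / d + ((d : ℝ) * (d - 1) - i * (i - 1)) / (2 * d) by linarith) hε
    simp only [Real.toNNReal_coe] at e
    linarith
  -- the last bond is longer than `2` at time `T + κ`
  have hlate : 2 < X d (T + κ).toNNReal ω - X (d - 1) (T + κ).toNNReal ω := by
    have e := bond_length_eq hd hε (fun i t => X i t ω) hd (t := T + κ)
    have h1 := (abs_le.1 (hdiff (T + κ) (by linarith) (by linarith) d le_rfl)).1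
    have h3 : κ * (T - (T + κ) + 4) / (32 * d) < κ / d := by
      rw [div_lt_div_iff₀ (by positivity) hdpos]
      have : κ * (T - (T + κ) + 4) < 32 * κ := by nlinarith
      nlinarith
    have h4 := mul_lt_mul_of_pos_left h3 hε
    have h5 : (asymptoticBreakTime d ε - (T + κ)) / d
        + ((d : ℝ) * (d - 1) - d * (d - 1)) / (2 * d) = -(κ / d) := by
      rw [← hTdef]; field_simp; ring
    rw [h5] at e
    linarith
  have hlow : ∀ i, 1 ≤ i → i ≤ d → ((T - κ : ℝ) : EReal) ≤ bondBreakTime X i ω := by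
    intro i hi hid
    refine le_iInf₂ fun t ht => EReal.coe_le_coe_iff.2 ?_
    by_contra! hlt
    exact (hearly i hi hid t hlt.le).ne ht
  have hlow' : ∀ i, 1 ≤ i → i < d → ((T + κ : ℝ) : EReal) ≤ bondBreakTime X i ω := by
    intro i hi hid
    refine le_iInf₂ fun t ht => EReal.coe_le_coe_iff.2 ?_
    by_contra! hlt
    exact (hother i hi hid t hlt.le).ne ht
  have hup : bondBreakTime X d ω < ((T + κ : ℝ) : EReal) := by
    have hcont : Continuous fun t : ℝ≥0 => X d t ω - X (d - 1) t ω :=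
      (hx.continuous d le_rfl).sub (hx.continuous (d - 1) (by omega))
    have hzero : X d 0 ω - X (d - 1) 0 ω ≤ 2 := by
      rw [hx.initial d le_rfl, hx.initial (d - 1) (by omega), Nat.cast_sub hd]
      push_cast; linarith
    obtain ⟨t, ht, hteq⟩ := intermediate_value_Icc (zero_le : 0 ≤ (T + κ).toNNReal)
      hcont.continuousOn ⟨hzero, hlate.le⟩
    have hne : t ≠ (T + κ).toNNReal := by
      rintro rfl
      exact hlate.ne' hteq
    have hlt : (t : ℝ) < T + κ := by
      have := NNReal.coe_lt_coe.2 (lt_of_le_of_ne ht.2 hne)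
      rwa [Real.coe_toNNReal _ (by linarith)] at this
    exact (iInf₂_le t hteq).trans_lt (EReal.coe_lt_coe_iff.2 hlt)
  have hchain : chainBreakTime d X ω = bondBreakTime X d ω := by
    refine le_antisymm (iInf₂_le d (Finset.mem_Icc.2 ⟨hd, le_rfl⟩)) (le_iInf₂ fun i hi => ?_)
    obtain ⟨hi1, hid⟩ := Finset.mem_Icc.1 hi
    rcases hid.lt_or_eq with h | rfl
    · exact hup.le.trans (hlow' i hi1 h)
    · exact le_rfl
  refine ⟨hchain, fun i hi hid => ?_, ?_⟩
  · rw [hchain]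
    exact (hup.trans_le (hlow' i hi hid)).ne
  · rw [hchain]
    have hl := hlow d hd le_rfl
    generalize bondBreakTime X d ω = τ at hl hup
    induction τ with
    | bot => exact absurd (le_bot_iff.1 hl) (EReal.coe_ne_bot _)
    | top => exact absurd hup not_top_lt
    | coe r =>
      rw [← EReal.coe_sub, EReal.abs_def]
      refine ENNReal.ofReal_le_ofReal (abs_le.2 ⟨?_, ?_⟩)
      · linarith [EReal.coe_le_coe_iff.1 hl]
      · linarith [EReal.coe_lt_coe_iff.1 hup]

/-! ### Convergence in probability -/

theorem IsBrownianChain.ae_isChainPath {Ω : Type*} [MeasurableSpace Ω] {d : ℕ} {ε σ : ℝ}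
    {B X : ℕ → ℝ≥0 → Ω → ℝ} {P : Measure Ω} (h : IsBrownianChain d ε σ B X P) :
    ∀ᵐ ω ∂P, IsChainPath d ε (fun i t => σ * B i t ω) (fun i t => X i t ω) := by
  filter_upwards [h.continuous_paths, h.initial, h.left_end, h.right_end, h.sde]
    with ω h1 h2 h3 h4 h5
  exact ⟨h1, h2, h3, h4, h5⟩

theorem tendsto_asymptoticBreakTime {ι : Type*} {l : Filter ι} {d : ℕ} (hd : 1 ≤ d) {ε : ι → ℝ}
    (hε : ∀ n, 0 < ε n) (hε0 : Tendsto ε l (𝓝 0)) :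
    Tendsto (fun n => asymptoticBreakTime d (ε n)) l atTop := by
  have hdpos : (0 : ℝ) < d := by exact_mod_cast hd
  have h1 : Tendsto ε l (𝓝[>] 0) :=
    tendsto_nhdsWithin_iff.2 ⟨hε0, Eventually.of_forall hε⟩
  exact tendsto_atTop_add_const_right _ _ (h1.inv_tendsto_nhdsGT_zero.const_mul_atTop hdpos)

/-- With probability tending to one, the last bond breaks first and near the asymptotic break
time. -/
theorem tendsto_measure_not_lastBondBreaksNear {ι : Type*} {l : Filter ι} {d : ℕ} (hd : 1 ≤ d)
    {ε σ : ι → ℝ} (hε : ∀ n, 0 < ε n) (hσ : ∀ n, 0 ≤ σ n) (hε0 : Tendsto ε l (𝓝 0))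
    (hσε : Tendsto (fun n => σ n / ε n) l (𝓝 0))
    {Ω : ι → Type*} [∀ n, MeasurableSpace (Ω n)] {P : ∀ n, Measure (Ω n)}
    {B X : ∀ n, ℕ → ℝ≥0 → Ω n → ℝ}
    (hX : ∀ n, IsBrownianChain d (ε n) (σ n) (B n) (X n) (P n)) {κ : ℝ} (hκ0 : 0 < κ)
    (hκ : κ ≤ 1 / 4) :
    Tendsto (fun n => P n
      {ω | ¬ LastBondBreaksNear d (X n) (asymptoticBreakTime d (ε n)) κ ω}) l (𝓝 0) := by
  obtain ⟨A, hA, hbound⟩ := exists_abs_deviation_le hd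
  have hdpos : (0 : ℝ) < d := by exact_mod_cast hd
  set δ : ℝ := κ / (64 * d) with hδ
  have hδ0 : 0 < δ := by positivity
  -- the noise level for which the noise contributes half of the admissible deviation
  set η : ℝ := δ / (2 * A) with hη
  have hη0 : 0 < η := by positivity
  have hT := tendsto_asymptoticBreakTime hd hε hε0
  have hlim : Tendsto (fun n => ENNReal.ofReal
      (d * (∑' n : ℕ, 1 / ((n : ℝ) + 1) ^ 2) * (σ n / (η * ε n)) ^ 2)) l (𝓝 0) := by
    have h1 : Tendsto (fun n => (d : ℝ) * (∑' n : ℕ, 1 / ((n : ℝ) + 1) ^ 2)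
        * (η⁻¹ * (σ n / ε n)) ^ 2) l (𝓝 0) := by
      have := ((hσε.const_mul η⁻¹).pow 2).const_mul
        ((d : ℝ) * (∑' n : ℕ, 1 / ((n : ℝ) + 1) ^ 2))
      rwa [mul_zero, zero_pow two_ne_zero, mul_zero] at this
    have h2 := ENNReal.tendsto_ofReal h1
    rw [ENNReal.ofReal_zero] at h2
    refine h2.congr fun n => ?_
    congr 3
    have := (hε n).ne'
    field_simp
  refine tendsto_of_tendsto_of_tendsto_of_le_of_le' tendsto_const_nhds hlim
    (Eventually.of_forall fun n => zero_le) ?_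
  filter_upwards [hT.eventually_ge_atTop 0, hT.eventually_ge_atTop η⁻¹] with n hn0 hn1
  set T := asymptoticBreakTime d (ε n) with hTdef
  set K : ℕ := ⌈T⌉₊ + 1 with hK
  have hKge : T + 1 ≤ K := by
    rw [hK]; push_cast; linarith [Nat.le_ceil T]
  have hKle : (K : ℝ) ≤ T + 2 := by
    rw [hK]; push_cast; linarith [Nat.ceil_lt_add_one hn0]
  have hKpos : (0 : ℝ) < K := by linarith
  have hKinv : 1 / (K : ℝ) ≤ η := by
    rw [div_le_iff₀ hKpos]
    have : η * η⁻¹ = 1 := mul_inv_cancel₀ hη0.ne'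
    nlinarith
  refine le_trans (measure_mono_ae ?_) (measure_exists_increment_gt_le (d := d)
    (fun i hi0 hid => (hX n).brownian i hi0 hid) (hσ n) (mul_pos hη0 (hε n)) K)
  filter_upwards [(hX n).ae_isChainPath] with ω hω hnot
  by_contra hgood
  refine hnot (lastBondBreaksNear_of_deviation_le hd (hε n) hκ0 hκ hδ hω hn0 ?_)
  intro t ht0 ht i hi
  have h1 := hbound (ε n) (η * ε n) K _ _ (hε n) (mul_pos hη0 (hε n)).le (Nat.succ_pos _) hω
    (fun j hj i hi0 hid s hs => by
      by_contra! hlt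
      exact hgood ⟨j, hj, i, hi0, hid, s, hs, hlt⟩) t ht0 (ht.trans hKge) i hi
  refine h1.trans ?_
  have h2 : A * (ε n / K + η * ε n) ≤ δ * ε n := by
    have h3 : ε n / K ≤ η * ε n := by
      rw [div_eq_mul_one_div, mul_comm]
      exact mul_le_mul_of_nonneg_right hKinv (hε n).le
    calc A * (ε n / K + η * ε n) ≤ A * (η * ε n + η * ε n) := by gcongr
      _ = δ * ε n := by rw [hη]; field_simp; ring
  have h4 : (t : ℝ) - 1 ≤ ⌊t⌋₊ := (Nat.sub_one_lt_floor t).le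
  have h5 : (⌊t⌋₊ : ℝ) ≤ t := Nat.floor_le ht0
  exact mul_le_mul h2 (by linarith) (by linarith) (by have := hε n; positivity)

theorem mainTheorem1 {ι : Type*} (l : Filter ι) (d : ℕ) (hd : 1 ≤ d) (ε σ : ι → ℝ)
    (hε : ∀ n, 0 < ε n) (hσ : ∀ n, 0 ≤ σ n) (hε0 : Tendsto ε l (𝓝 0))
    (hregime : Tendsto (fun n => σ n / ε n) l (𝓝 0) ∨ ∀ n, σ n = 0)
    {Ω : ι → Type*} [∀ n, MeasurableSpace (Ω n)] (P : ∀ n, Measure (Ω n))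
    [∀ n, IsProbabilityMeasure (P n)] (B X : ∀ n, ℕ → ℝ≥0 → Ω n → ℝ)
    (hX : ∀ n, IsBrownianChain d (ε n) (σ n) (B n) (X n) (P n)) :
    (∀ i ∈ Finset.Icc 1 d,
      Tendsto (fun n => P n {ω | chainBreakTime d (X n) ω = bondBreakTime (X n) i ω}) l
        (𝓝 (if i = d then 1 else 0))) ∧
    IsLittleOPOne P l (fun n ω => chainBreakTime d (X n) ω
      - (((d : ℝ) / ε n - ((d : ℝ) - 1) * (2 * (d : ℝ) - 1) / 6 : ℝ) : EReal)) := by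
  have hσε : Tendsto (fun n => σ n / ε n) l (𝓝 0) := by
    rcases hregime with h | h
    · exact h
    · simpa [h] using tendsto_const_nhds
  have hbad := fun {κ : ℝ} (h0 : 0 < κ) (h1 : κ ≤ 1 / 4) =>
    tendsto_measure_not_lastBondBreaksNear hd hε hσ hε0 hσε hX h0 h1
  have hquarter := hbad (κ := 1 / 4) (by norm_num) le_rfl
  refine ⟨fun i hi => ?_, fun κ hκ => ?_⟩
  · obtain ⟨hi1, hid⟩ := Finset.mem_Icc.1 hi
    rcases hid.lt_or_eq with h | rfl
    · rw [if_neg h.ne]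
      exact tendsto_of_tendsto_of_tendsto_of_le_of_le tendsto_const_nhds hquarter
        (fun n => zero_le) fun n => measure_mono fun ω hω hgood => hgood.2.1 i hi1 h hω
    · rw [if_pos rfl]
      have hlow : Tendsto (fun n => 1 - P n {ω | ¬ LastBondBreaksNear i (X n)
          (asymptoticBreakTime i (ε n)) (1 / 4) ω}) l (𝓝 1) := by
        simpa using ENNReal.Tendsto.sub (tendsto_const_nhds (x := (1 : ℝ≥0∞))) hquarter
          (Or.inl ENNReal.one_ne_top)
      -- subadditivity gives the lower bound without measurability of the break times
      refine tendsto_of_tendsto_of_tendsto_of_le_of_le hlow tendsto_const_nhds (fun n => ?_)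
        fun n => prob_le_one
      refine tsub_le_iff_right.2 ?_
      rw [← measure_univ (μ := P n)]
      refine (measure_mono fun ω _ => ?_).trans (measure_union_le _ _)
      by_cases hgood : LastBondBreaksNear i (X n) (asymptoticBreakTime i (ε n)) (1 / 4) ω
      · exact Or.inl hgood.1
      · exact Or.inr hgood
  · have hmin : 0 < min (κ / 2) (1 / 4) := lt_min (by linarith) (by norm_num)
    refine tendsto_of_tendsto_of_tendsto_of_le_of_le tendsto_const_nhds
      (hbad hmin (min_le_right _ _)) (fun n => zero_le) fun n => measure_mono fun ω hω hgood => ?_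
    have h1 : ENNReal.ofReal κ ≤ ENNReal.ofReal (min (κ / 2) (1 / 4)) := le_trans hω hgood.2.2
    have h2 := (ENNReal.ofReal_le_ofReal_iff hmin.le).1 h1
    linarith [min_le_left (κ / 2) (1 / 4 : ℝ)]
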